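/- For a finite group $G$ put $$\sigma_1(G)=\frac{1}{|G|}\sum_{H\le G}|H|,$$ the sum running over all subgroups $H$ of $G$. **Lemma.** Let $G$ be a finite group with $\sigma_1(G)<3$. Then $G$ is nilpotent, or $G$ is of the following type: $G=G_1\times K_1$, where $K_1$ is a cyclic Hall subgroup of $G$ (that is, $|K_1|$ and $|G:K_1|$ are coprime; $K_1=1$ is allowed) and, for some prime $p$, $G_1=P\rtimes K_2$ is a non-nilpotent group satisfying the following conditions: - $P$ is a (normal) Sylow $p$-subgroup of $G_1$ and the complement $K_2$ is cyclic; - the centralizer $C_P(K_2)$ of $K_2$ in $P$ contains the Frattini subgroup $\Phi(P)$; - $C_P(K_2)$ is a cyclic normal subgroup of $G_1$; - $K_2C_P(K_2)/C_P(K_2)$ is a maximal subgroup of $G_1/C_P(K_2)$. -/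

import Mathlib

/-- The function `σ₁(G) = (1/|G|) ∑_{H ≤ G} |H|`, the sum running over all subgroups of a
(finite) group `G`. -/
noncomputable def sigmaOne (G : Type*) [Group G] : ℚ :=
  1 / (Nat.card G : ℚ) * ∑ᶠ H : Subgroup G, (Nat.card H : ℚ)

/-- The centralizer `C_P(K) = {x ∈ P | x commutes with every element of K}`, as a subgroup of
the ambient group. -/
def centralizerIn {G : Type*} [Group G] (P K : Subgroup G) : Subgroup G :=
  P ⊓ Subgroup.centralizer (K : Set G)

/-- The factor `G₁` in groups of type c): `G₁` is non-nilpotent, and `G₁ = P ⋊ K₂` is an internal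
semidirect product in which `P` is a (normal) Sylow `p`-subgroup of `G₁`, `K₂` is cyclic,
`Φ(P) ≤ C_P(K₂)`, and `C_P(K₂)` is a cyclic normal subgroup of `G₁` such that
`K₂ C_P(K₂) / C_P(K₂)` is a maximal subgroup of `G₁ / C_P(K₂)`. -/
def IsTypeCFactor (p : ℕ) (G₁ : Type*) [Group G₁] : Prop :=
  ¬ Group.IsNilpotent G₁ ∧
  ∃ (P : Sylow p G₁) (K₂ : Subgroup G₁),
    (P : Subgroup G₁).Normal ∧
    Subgroup.IsComplement' (P : Subgroup G₁) K₂ ∧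
    IsCyclic K₂ ∧
    (frattini (P : Subgroup G₁)).map (P : Subgroup G₁).subtype ≤ centralizerIn (P : Subgroup G₁) K₂ ∧
    IsCyclic (centralizerIn (P : Subgroup G₁) K₂) ∧
    ∃ _ : (centralizerIn (P : Subgroup G₁) K₂).Normal,
      IsCoatom ((K₂ ⊔ centralizerIn (P : Subgroup G₁) K₂).map
        (QuotientGroup.mk' (centralizerIn (P : Subgroup G₁) K₂)))

/-- Groups of type c): `G = G₁ × K₁` (internal direct product), where `K₁` is a cyclic Hall
subgroup of `G` (its order and its index are coprime) and, for some prime `p`, `G₁ = P ⋊ K₂` is as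
in `IsTypeCFactor`. -/
def IsTypeC (G : Type*) [Group G] : Prop :=
  ∃ (p : ℕ) (G₁ K₁ : Subgroup G),
    p.Prime ∧
    Subgroup.IsComplement' G₁ K₁ ∧
    (∀ x ∈ G₁, ∀ y ∈ K₁, x * y = y * x) ∧
    IsCyclic K₁ ∧
    Nat.Coprime (Nat.card K₁) K₁.index ∧
    IsTypeCFactor p G₁

/-! The conjugacy class of `H` contributes `|G : N(H)| * |H|` to the sum, hence exactly `|G|` when
`H` is self-normalizing. Since `G` itself contributes `|G|`, a total below `3|G|` leaves room for
only one class of proper self-normalizing subgroups, and for little else besides it. If `G` is not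
nilpotent, a non-normal maximal subgroup `M` represents that class. Normalizers of non-normal Sylow
subgroups are conjugate to `M`, which makes `M` nilpotent; counting its subgroups of prime index
makes it cyclic. For a prime `p` dividing `|G : M|`, the Sylow `p`-subgroup `P` is normal, and a
complement `K` of `P ⊓ M` in `M` has centralizer `M`, so `C_P(K) = P ⊓ M`. The factor `K₁` can be
taken trivial. -/

open scoped Pointwise
open Subgroup

/-! ### Counting subgroups by conjugacy class. -/

namespace Subgroup

variable {G : Type*} [Group G]

theorem card_conjAct_smul (g : ConjAct G) (H : Subgroup G) :
    Nat.card (g • H : Subgroup G) = Nat.card H :=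
  (Nat.card_congr (equivSMul g H).toEquiv).symm

theorem index_stabilizer_conjAct (H : Subgroup G) :
    (MulAction.stabilizer (ConjAct G) H).index = (normalizer (H : Set G)).index := by
  have h : (MulAction.stabilizer (ConjAct G) H).comap
      (ConjAct.toConjAct : G ≃* ConjAct G).toMonoidHom = normalizer (H : Set G) := by
    ext g
    exact conjAct_pointwise_smul_iff
  rw [← h, index_comap_of_surjective]
  exact (ConjAct.toConjAct : G ≃* ConjAct G).surjective

theorem normalizer_conjAct_smul (g : ConjAct G) (H : Subgroup G) :
    normalizer ((g • H : Subgroup G) : Set G) = g • normalizer (H : Set G) :=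
  (map_equiv_normalizer_eq H (MulDistribMulAction.toMulEquiv G g)).symm

/-- The sum of the orders of all subgroups is at least the sum of the orders of the members of
the conjugacy classes of pairwise non-conjugate subgroups. -/
theorem sum_index_normalizer_mul_card_le [Finite G] (T : Finset (Subgroup G))
    (hT : ∀ H ∈ T, ∀ L ∈ T, ∀ g : ConjAct G, g • H = L → H = L) :
    ∑ H ∈ T, (normalizer (H : Set G)).index * Nat.card H ≤ ∑ᶠ H : Subgroup G, Nat.card H := by
  classical
  have := Fintype.ofFinite (Subgroup G)
  rw [finsum_eq_sum_of_fintype]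
  let orb (H : Subgroup G) : Finset (Subgroup G) := (MulAction.orbit (ConjAct G) H).toFinset
  have hsum (H : Subgroup G) :
      ∑ L ∈ orb H, Nat.card L = (normalizer (H : Set G)).index * Nat.card H := by
    rw [Finset.sum_const_nat (m := Nat.card H)]
    · rw [← index_stabilizer_conjAct, MulAction.index_stabilizer, Set.ncard_eq_toFinset_card']
    · intro L hL
      obtain ⟨g, rfl⟩ := Set.mem_toFinset.mp hL
      exact card_conjAct_smul g H
  have hdisj : (T : Set (Subgroup G)).PairwiseDisjoint orb := by
    intro H hH L hL hne
    refine Finset.disjoint_left.mpr fun J hJ hJ' => hne ?_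
    obtain ⟨g, rfl⟩ := Set.mem_toFinset.mp hJ
    obtain ⟨k, hk⟩ := Set.mem_toFinset.mp hJ'
    refine hT H hH L hL (k⁻¹ * g) ?_
    rw [mul_smul, inv_smul_eq_iff]
    exact hk.symm
  rw [← Finset.sum_congr rfl fun H _ => hsum H, ← Finset.sum_biUnion hdisj]
  exact Finset.sum_le_sum_of_subset (Finset.subset_univ _)

end Subgroup

/-! ### Self-normalizing subgroups under the bound. -/

section

variable {G : Type*} [Group G] [Finite G]

theorem sum_card_lt_of_sigmaOne_lt {n : ℕ} (hG : sigmaOne G < n) :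
    ∑ᶠ H : Subgroup G, Nat.card H < n * Nat.card G := by
  have := Fintype.ofFinite (Subgroup G)
  have h0 : (0 : ℚ) < Nat.card G := by exact_mod_cast Nat.card_pos
  rw [sigmaOne, finsum_eq_sum_of_fintype, one_div, inv_mul_lt_iff₀ h0] at hG
  rw [finsum_eq_sum_of_fintype, mul_comm]
  exact_mod_cast hG

/-- Proper self-normalizing subgroups are conjugate. -/
theorem exists_smul_eq_of_sigmaOne_lt_three (hG : sigmaOne G < 3) {H M : Subgroup G}
    (hH : normalizer (H : Set G) = H) (hM : normalizer (M : Set G) = M) (hH' : H ≠ ⊤)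
    (hM' : M ≠ ⊤) : ∃ g : ConjAct G, g • H = M := by
  classical
  by_contra! hne
  have htop (g : ConjAct G) : g • (⊤ : Subgroup G) = ⊤ := Normal.conjAct inferInstance g
  have hHM : H ≠ M := fun h => hne 1 (by rw [one_smul, h])
  have h := sum_index_normalizer_mul_card_le {⊤, H, M} (by
    have h1 (J : Subgroup G) (g : ConjAct G) : g • J = ⊤ → J = ⊤ := fun h => by
      rw [← inv_smul_eq_iff.mpr h.symm, htop]
    have h2 (g : ConjAct G) : g • M = H → M = H := fun h =>
      absurd (inv_smul_eq_iff.mpr h.symm) (hne g⁻¹)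
    have h3 (g : ConjAct G) : g • H = M → H = M := fun h => absurd h (hne g)
    simp only [Finset.mem_insert, Finset.mem_singleton]
    rintro A (rfl | rfl | rfl) B (rfl | rfl | rfl) g hg <;>
      first | rfl | exact h1 _ g hg | exact h2 g hg | exact h3 g hg | skip
    all_goals rw [htop] at hg; exact hg)
  rw [Finset.sum_insert (by simp [hH'.symm, hM'.symm]), Finset.sum_pair hHM, hH, hM,
    index_mul_card, index_mul_card, normalizer_eq_top, index_top, card_top] at h
  have := sum_card_lt_of_sigmaOne_lt (n := 3) (mod_cast hG)
  omega

/-- The subgroups whose normalizer is a given proper self-normalizing subgroup `M`, other than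
`M` itself, have total order less than that of `M`. -/
theorem sum_card_lt_card_of_sigmaOne_lt_three (hG : sigmaOne G < 3) {M : Subgroup G}
    (hM : normalizer (M : Set G) = M) (hM' : M ≠ ⊤) (T : Finset (Subgroup G))
    (hT : ∀ L ∈ T, normalizer (L : Set G) = M ∧ L ≠ M) :
    ∑ L ∈ T, Nat.card L < Nat.card M := by
  classical
  have htop (g : ConjAct G) : g • (⊤ : Subgroup G) = ⊤ := Normal.conjAct inferInstance g
  have hMT : M ∉ T := fun h => (hT M h).2 rfl
  have hnorm : ∀ L ∈ insert M T, normalizer (L : Set G) = M := by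
    intro L hL
    obtain rfl | hL := Finset.mem_insert.mp hL
    exacts [hM, (hT L hL).1]
  have htopT : ⊤ ∉ insert M T := fun h => hM' ((hnorm ⊤ h).symm.trans (normalizer_eq_top ⊤))
  have h := sum_index_normalizer_mul_card_le (insert ⊤ (insert M T)) (by
    intro A hA B hB g hg
    obtain rfl | hA := Finset.mem_insert.mp hA
    · rw [← hg, htop]
    obtain rfl | hB := Finset.mem_insert.mp hB
    · rw [← inv_smul_eq_iff.mpr hg.symm, htop]
    -- An element conjugating `A` to `B` fixes their common normalizer `M`, so it lies in `N(M) = M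
    -- = N(A)` and fixes `A`.
    have hgM : g • M = M := by
      rw [← hnorm A hA, ← normalizer_conjAct_smul, hg, hnorm B hB, hnorm A hA]
    have hgA : ConjAct.ofConjAct g ∈ normalizer (A : Set G) := by
      rw [hnorm A hA, ← hM]
      exact conjAct_pointwise_smul_iff.mp hgM
    exact (conjAct_pointwise_smul_iff.mpr hgA).symm.trans hg)
  rw [Finset.sum_insert htopT, Finset.sum_insert hMT, hM, index_mul_card, normalizer_eq_top,
    index_top, card_top, Finset.sum_congr rfl fun L hL => by rw [(hT L hL).1],
    ← Finset.mul_sum] at h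
  have h3 := sum_card_lt_of_sigmaOne_lt (n := 3) (mod_cast hG)
  have hlt : M.index * ∑ L ∈ T, Nat.card L < M.index * Nat.card M := by
    rw [index_mul_card]
    omega
  exact lt_of_mul_lt_mul_left hlt (Nat.zero_le _)

end

/-! ### Subgroups of prime index, and cyclicity of `M`. -/

section

/-- A noncyclic finite `p`-group has more than `p` subgroups of index `p`. -/
theorem IsPGroup.lt_card_index_eq {p : ℕ} [hp : Fact p.Prime] {Q : Type*} [Group Q] [Finite Q]
    (hQ : IsPGroup p Q) (hc : ¬ IsCyclic Q) :
    ∃ T : Finset (Subgroup Q), p < T.card ∧ ∀ L ∈ T, L.Normal ∧ L.index = p := by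
  classical
  have := Fintype.ofFinite (Subgroup Q)
  have := Fintype.ofFinite Q
  obtain ⟨n, hn⟩ := hQ.exists_card_eq
  have hn0 : n ≠ 0 := by
    rintro rfl
    have : Subsingleton Q := (Nat.card_eq_one_iff_unique.mp (by simpa using hn)).1
    exact hc inferInstance
  obtain ⟨k, rfl⟩ := Nat.exists_eq_succ_of_ne_zero hn0
  have hindex (L : Subgroup Q) : L.index = p ↔ Nat.card L = p ^ k := by
    have h := L.index_mul_card
    rw [hn, pow_succ'] at h
    constructor
    · intro hL
      rw [hL] at h
      exact Nat.eq_of_mul_eq_mul_left hp.out.pos h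
    · intro hL
      rw [hL] at h
      exact Nat.eq_of_mul_eq_mul_right (pow_pos hp.out.pos k) h
  have hcover (x : Q) : ∃ L : Subgroup Q, L.index = p ∧ x ∈ L := by
    obtain ⟨m, hmn, hm⟩ := (Nat.dvd_prime_pow hp.out).mp (hn ▸ (zpowers x).card_subgroup_dvd_card)
    have hmk : m ≤ k := by
      by_contra! hlt
      obtain rfl : m = k + 1 := by omega
      have htop : zpowers x = ⊤ := eq_top_of_card_eq _ (hm.trans hn.symm)
      exact hc ⟨x, fun y => show y ∈ zpowers x from htop.symm ▸ mem_top y⟩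
    obtain ⟨L, hL, hxL⟩ := Sylow.exists_subgroup_card_pow_prime_le p
      (hn ▸ pow_dvd_pow p (Nat.le_succ k)) (zpowers x) hm hmk
    exact ⟨L, (hindex L).mpr hL, hxL (mem_zpowers x)⟩
  refine ⟨Finset.univ.filter fun L => L.index = p, ?_, fun L hL => ?_⟩
  · set T : Finset (Subgroup Q) := Finset.univ.filter fun L => L.index = p
    have hsub : (Finset.univ.erase (1 : Q)) ⊆
        T.biUnion fun L => (L : Set Q).toFinset.erase 1 := by
      intro x hx
      obtain ⟨L, hL, hxL⟩ := hcover x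
      refine Finset.mem_biUnion.mpr ⟨L, by simpa [T] using hL, ?_⟩
      simpa [hxL] using hx
    -- Counting nonidentity elements gives `p ^ (k + 1) - 1 ≤ |T| * (p ^ k - 1)`, impossible for
    -- `|T| ≤ p`.
    have h1 := (Finset.card_le_card hsub).trans (Finset.card_biUnion_le_card_mul _ _ (p ^ k - 1)
      fun L hL => by
        have hL' : L.index = p := (Finset.mem_filter.mp hL).2
        rw [Finset.card_erase_of_mem (by simp [one_mem]), ← Set.ncard_eq_toFinset_card',
          ← Nat.card_coe_set_eq]
        exact (congrArg (· - 1) ((hindex L).mp hL')).le)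
    rw [Finset.card_erase_of_mem (Finset.mem_univ _), Finset.card_univ, ← Nat.card_eq_fintype_card,
      hn] at h1
    by_contra! hle
    have h2 := h1.trans (Nat.mul_le_mul_right _ hle)
    rw [Nat.mul_sub, mul_one, Nat.succ_eq_add_one, pow_succ'] at h2
    have h3 := hp.out.two_le
    have h4 : p ≤ p * p ^ k := Nat.le_mul_of_pos_right _ (pow_pos hp.out.pos k)
    omega
  · have hL' : L.index = p := (Finset.mem_filter.mp hL).2
    exact ⟨normal_of_index_eq_minFac_card (by rw [hL', hn, hp.out.pow_minFac (by simp)]), hL'⟩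

/-- A noncyclic finite nilpotent group has, for some prime `p`, more than `p` normal subgroups of
index `p`. -/
theorem Group.IsNilpotent.exists_lt_card_index_eq {X : Type*} [Group X] [Finite X]
    (hX : Group.IsNilpotent X) (hc : ¬ IsCyclic X) :
    ∃ p : ℕ, p.Prime ∧ ∃ T : Finset (Subgroup X), p < T.card ∧
      ∀ L ∈ T, L.Normal ∧ L.index = p := by
  classical
  have hz : ¬ IsZGroup X := fun _ => hc inferInstance
  obtain ⟨p, hp, P, hP⟩ : ∃ p : ℕ, ∃ _ : p.Prime, ∃ P : Sylow p X, ¬ IsCyclic P := by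
    by_contra! h
    exact hz ⟨h⟩
  have := Fact.mk hp
  have hdvd : p ∣ Nat.card X := by
    by_contra hdvd
    have h1 : Nat.card P = 1 :=
      P.card_eq_multiplicity.trans (by rw [Nat.factorization_eq_zero_of_not_dvd hdvd, pow_zero])
    have : Subsingleton P := (Nat.card_eq_one_iff_unique.mp h1).1
    exact hP inferInstance
  obtain ⟨e⟩ := ((Group.isNilpotent_of_finite_tfae (G := X)).out 0 4).mp hX
  let q : (Nat.card X).primeFactors := ⟨p, Nat.mem_primeFactors.mpr ⟨hp, hdvd, Nat.card_pos.ne'⟩⟩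
  let f : X →* P := ((Pi.evalMonoidHom (fun P : Sylow p X => (P : Subgroup X)) P).comp
    (Pi.evalMonoidHom
      (fun q : (Nat.card X).primeFactors => ∀ P : Sylow q X, (P : Subgroup X)) q)).comp
    e.symm.toMonoidHom
  have hf : Function.Surjective f :=
    ((Function.surjective_eval (β := fun P : Sylow p X => (P : Subgroup X)) P).comp
      (Function.surjective_eval
        (β := fun q : (Nat.card X).primeFactors => ∀ P : Sylow q X, (P : Subgroup X)) q)).comp
      e.symm.surjective
  obtain ⟨T, hT, hT'⟩ := P.2.lt_card_index_eq hP
  refine ⟨p, hp, T.map ⟨comap f, comap_injective hf⟩, by rwa [Finset.card_map], fun L hL => ?_⟩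
  obtain ⟨J, hJ, rfl⟩ := Finset.mem_map.mp hL
  have := (hT' J hJ).1
  exact ⟨normal_comap f, (index_comap_of_surjective J hf).trans (hT' J hJ).2⟩

variable {G : Type*} [Group G] {M : Subgroup G}

theorem IsCoatom.normalizer_eq_of_not_normal (hM : IsCoatom M) (hn : ¬ M.Normal) :
    normalizer (M : Set G) = M :=
  (hM.le_iff_eq fun h => hn (normalizer_eq_top_iff.mp h)).mp le_normalizer

variable [Finite G]

/-- A normal Sylow subgroup of `G` meets `M` in a normal Sylow subgroup of `M`; a non-normal one has
a conjugate whose normalizer is `M`. -/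
theorem isNilpotent_of_sigmaOne_lt_three (hG : sigmaOne G < 3)
    (hM : normalizer (M : Set G) = M) (hM' : M ≠ ⊤) : Group.IsNilpotent M := by
  refine ((Group.isNilpotent_of_finite_tfae (G := M)).out 0 3).mpr fun q hq P => ?_
  have : Fact q.Prime := hq
  obtain ⟨Q⟩ := (inferInstance : Nonempty (Sylow q G))
  by_cases hQ : (Q : Subgroup G).Normal
  · have hle : (P : Subgroup M).map M.subtype ≤ Q := by
      obtain ⟨R, hR⟩ := (P.2.map M.subtype).exists_le_sylow
      have := Sylow.unique_of_normal Q hQ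
      rwa [Subsingleton.elim R Q] at hR
    have heq : (Q : Subgroup G).subgroupOf M = P :=
      P.3 (Q.2.comap_of_injective M.subtype M.subtype_injective) (map_le_iff_le_comap.mp hle)
    rw [← heq]
    exact normal_subgroupOf
  · obtain ⟨g, hg⟩ := exists_smul_eq_of_sigmaOne_lt_three hG Q.normalizer_normalizer hM
      (fun h => hQ (normalizer_eq_top_iff.mp h)) hM'
    have hR : normalizer (((g • Q : Sylow q G) : Subgroup G) : Set G) = M :=
      (normalizer_conjAct_smul g Q).trans hg
    have hle : ((g • Q : Sylow q G) : Subgroup G) ≤ M := le_normalizer.trans_eq hR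
    have hnorm : ((g • Q).subtype hle : Subgroup M).Normal :=
      (normal_subgroupOf_iff_le_normalizer hle).mpr hR.ge
    have := Sylow.unique_of_normal ((g • Q).subtype hle) hnorm
    rwa [Subsingleton.elim P ((g • Q).subtype hle)]

theorem sup_eq_top_of_index_eq_prime {X : Type*} [Group X] [Finite X] {p : ℕ} (hp : p.Prime)
    {H L : Subgroup X} (hH : H.index = p) (hL : L.index = p) (hne : H ≠ L) : H ⊔ L = ⊤ := by
  by_contra h
  have hi : (H ⊔ L).index = p :=
    (hp.eq_one_or_self_of_dvd _ (hH ▸ index_dvd_of_le le_sup_left)).resolve_left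
      fun h1 => h (index_eq_one.mp h1)
  have key {J : Subgroup X} (hle : J ≤ H ⊔ L) (hJ : J.index = p) : J = H ⊔ L := by
    refine eq_of_le_of_card_ge hle (le_of_eq ?_)
    have h1 := J.index_mul_card
    have h2 := (H ⊔ L).index_mul_card
    rw [hJ] at h1
    rw [hi] at h2
    exact Nat.eq_of_mul_eq_mul_left hp.pos (h2.trans h1.symm)
  exact hne ((key le_sup_left hH).trans (key le_sup_right hL).symm)

/-- Otherwise `M` has at least `q` subgroups of order `|M| / q` with normalizer `M`; their total
order reaches `|M|`, which the bound forbids. -/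
theorem isCyclic_of_sigmaOne_lt_three (hG : sigmaOne G < 3) (hM : IsCoatom M)
    (hn : ¬ M.Normal) : IsCyclic M := by
  classical
  have hself := hM.normalizer_eq_of_not_normal hn
  by_contra hc
  obtain ⟨q, hq, T, hT, hT'⟩ :=
    (isNilpotent_of_sigmaOne_lt_three hG hself hM.1).exists_lt_card_index_eq hc
  -- Two distinct members normal in `G` would generate `M`, making it normal.
  have hone : (T.filter fun L => (L.map M.subtype).Normal).card ≤ 1 := by
    refine Finset.card_le_one.mpr fun A hA B hB => ?_
    obtain ⟨hA, hA'⟩ := Finset.mem_filter.mp hA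
    obtain ⟨hB, hB'⟩ := Finset.mem_filter.mp hB
    by_contra hne
    have h := sup_eq_top_of_index_eq_prime hq (hT' A hA).2 (hT' B hB).2 hne
    refine hn ?_
    rw [← M.range_subtype, MonoidHom.range_eq_map, ← h, Subgroup.map_sup]
    infer_instance
  have hsplit := T.card_filter_add_card_filter_not fun L => (L.map M.subtype).Normal
  set S := T.filter fun L => ¬ (L.map M.subtype).Normal
  have hsum := sum_card_lt_card_of_sigmaOne_lt_three hG hself hM.1
    (S.map ⟨map M.subtype, map_injective M.subtype_injective⟩) (by
      intro L hL
      obtain ⟨J, hJ, rfl⟩ := Finset.mem_map.mp hL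
      obtain ⟨hJT, hJn⟩ := Finset.mem_filter.mp hJ
      have := (hT' J hJT).1
      have hle : M ≤ normalizer ((J.map M.subtype : Subgroup G) : Set G) := by
        refine (normal_subgroupOf_iff_le_normalizer (map_subtype_le J)).mp ?_
        rwa [subgroupOf, comap_map_eq_self_of_injective M.subtype_injective]
      refine ⟨(hM.le_iff_eq fun h => hJn (normalizer_eq_top_iff.mp h)).mp hle, fun h => ?_⟩
      have hJtop : J = ⊤ := map_injective M.subtype_injective
        (h.trans (by rw [← MonoidHom.range_eq_map, range_subtype]))
      have hJi := (hT' J hJT).2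
      rw [hJtop, index_top] at hJi
      exact hq.one_lt.ne hJi)
  have hcard : ∀ L ∈ S, q * Nat.card (L.map M.subtype) = Nat.card M := fun L hL => by
    rw [card_map_of_injective M.subtype_injective, ← (hT' L (Finset.mem_filter.mp hL).1).2,
      index_mul_card]
  rw [Finset.sum_map] at hsum
  have hmul := Nat.mul_lt_mul_of_pos_left hsum hq.pos
  rw [Finset.mul_sum] at hmul
  simp only [Function.Embedding.coeFn_mk] at hmul
  rw [Finset.sum_congr rfl hcard, Finset.sum_const, smul_eq_mul] at hmul
  have hqS : q ≤ S.card := by omega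
  exact (Nat.mul_le_mul_right _ hqS).not_gt hmul

end

/-! ### The semidirect decomposition. -/

section

/-- The order of `G / Z(G)` divides `|G : K| = |P|`, so this quotient is a `p`-group. -/
theorem isNilpotent_of_isPGroup_of_isComplement' {G : Type*} [Group G] [Finite G] {p : ℕ}
    [Fact p.Prime] {P K : Subgroup G} (hP : IsPGroup p P) (h : P.IsComplement' K)
    (hK : K ≤ center G) : Group.IsNilpotent G := by
  obtain ⟨n, hn⟩ := hP.exists_card_eq
  have hdvd : Nat.card (G ⧸ center G) ∣ p ^ n := by
    rw [← hn, ← h.index_eq_card]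
    exact index_dvd_of_le hK
  obtain ⟨m, -, hm⟩ := (Nat.dvd_prime_pow Fact.out).mp hdvd
  exact Group.of_quotient_center_nilpotent (IsPGroup.of_card hm).isNilpotent

variable {G : Type*} [Group G] {M : Subgroup G}

theorem isCoatom_map_mk' (hM : IsCoatom M) {C : Subgroup G} [C.Normal] (hC : C ≤ M) :
    IsCoatom (M.map (QuotientGroup.mk' C)) := by
  have hsurj := QuotientGroup.mk'_surjective C
  have hcomap : (M.map (QuotientGroup.mk' C)).comap (QuotientGroup.mk' C) = M :=
    comap_map_eq_self (by rwa [QuotientGroup.ker_mk'])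
  refine ⟨fun h => hM.1 ?_, fun J hJ => ?_⟩
  · rw [← hcomap, h, comap_top]
  · have hlt := (comap_lt_comap_of_surjective hsurj).mpr hJ
    rw [hcomap] at hlt
    exact comap_injective hsurj (by rw [hM.2 _ hlt, comap_top])

variable [Finite G]

theorem exists_sylow_normal_not_le (hG : sigmaOne G < 3) (hM : normalizer (M : Set G) = M)
    (hM' : M ≠ ⊤) : ∃ p : ℕ, p.Prime ∧
      ∃ P : Sylow p G, (P : Subgroup G).Normal ∧ ¬ (P : Subgroup G) ≤ M := by
  obtain ⟨p, hp, hpM⟩ := Nat.exists_prime_and_dvd fun h => hM' (index_eq_one.mp h)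
  have := Fact.mk hp
  have hnle (P : Sylow p G) : ¬ (P : Subgroup G) ≤ M := fun h =>
    P.not_dvd_index (hpM.trans (index_dvd_of_le h))
  obtain ⟨P⟩ := (inferInstance : Nonempty (Sylow p G))
  refine ⟨p, hp, P, ?_, hnle P⟩
  by_contra hn
  obtain ⟨g, hg⟩ := exists_smul_eq_of_sigmaOne_lt_three hG P.normalizer_normalizer hM
    (fun h => hn (normalizer_eq_top_iff.mp h)) hM'
  exact hnle (g • P) (le_normalizer.trans_eq ((normalizer_conjAct_smul g P).trans hg))

/-- A complement of the Sylow subgroup `P` inside a maximal subgroup not containing `P`. -/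
theorem exists_isComplement'_of_isCoatom {p : ℕ} [Fact p.Prime] (P : Sylow p G)
    [hP : (P : Subgroup G).Normal] (hM : IsCoatom M) (hPM : ¬ (P : Subgroup G) ≤ M) :
    ∃ K : Subgroup G, (P : Subgroup G).IsComplement' K ∧ K ⊔ ((P : Subgroup G) ⊓ M) = M := by
  have hsup : M ⊔ P = ⊤ := hM.2 _ (left_lt_sup.mpr hPM)
  have hindex : ((P : Subgroup G).subgroupOf M).index = (P : Subgroup G).index := by
    rw [← relIndex, ← relIndex_sup_right, hsup, relIndex_top_right]
  have hcop : (Nat.card (P : Subgroup G)).Coprime (P : Subgroup G).index := P.card_coprime_index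
  -- Schur–Zassenhaus in `M`; as `MP = G`, the order of `H` is `|G : P|`.
  obtain ⟨H, hH⟩ := exists_right_complement'_of_coprime
    (N := (P : Subgroup G).subgroupOf M) (by
      rw [hindex]
      refine hcop.coprime_dvd_left ?_
      rw [← card_map_of_injective M.subtype_injective, subgroupOf_map_subtype]
      exact card_dvd_of_le inf_le_left)
  have hK : Nat.card (H.map M.subtype) = (P : Subgroup G).index := by
    rw [card_map_of_injective M.subtype_injective, ← hindex, hH.symm.index_eq_card]
  refine ⟨H.map M.subtype, isComplement'_of_coprime ?_ (hK ▸ hcop), ?_⟩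
  · rw [hK, card_mul_index]
  · rw [← subgroupOf_map_subtype, ← Subgroup.map_sup, hH.symm.sup_eq_top,
      ← MonoidHom.range_eq_map, range_subtype]

/-- If `MΦ(P) = G`, Dedekind's law gives `P = (P ⊓ M)Φ(P)`, hence `P ≤ M`. -/
theorem map_frattini_le_of_isCoatom {P : Subgroup G} [P.Normal] (hM : IsCoatom M)
    (hPM : ¬ P ≤ M) : (frattini P).map P.subtype ≤ M := by
  by_contra hle
  have hsup : M ⊔ (frattini P).map P.subtype = ⊤ := hM.2 _ (left_lt_sup.mpr hle)
  refine hPM (subgroupOf_eq_top.mp (frattini_nongenerating ?_))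
  refine map_injective P.subtype_injective ?_
  rw [Subgroup.map_sup, subgroupOf_map_subtype, ← MonoidHom.range_eq_map, range_subtype]
  refine le_antisymm (sup_le inf_le_right (map_subtype_le _)) fun x hx => ?_
  have hx' : x ∈ M ⊔ (frattini P).map P.subtype := hsup ▸ mem_top x
  rw [← SetLike.mem_coe, mul_normal] at hx'
  obtain ⟨m, hm, f, hf, rfl⟩ := hx'
  have hfP : f ∈ P := map_subtype_le _ hf
  exact mul_mem_sup ⟨hm, (P.mul_mem_cancel_right hfP).mp hx⟩ hf

/-- The normalizer contains `M`, and strictly: normalizers grow in the nilpotent group `P`. -/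
theorem normal_inf_of_isCoatom {p : ℕ} [Fact p.Prime] {P : Subgroup G} [P.Normal]
    (hP : IsPGroup p P) (hM : IsCoatom M) (hPM : ¬ P ≤ M) : (P ⊓ M).Normal := by
  rw [← normalizer_eq_top_iff]
  refine hM.2 _ (lt_of_le_of_ne ?_ fun h => ?_)
  · refine (normal_subgroupOf_iff_le_normalizer inf_le_right).mp ?_
    rw [inf_subgroupOf_right]
    infer_instance
  · have hnil : Group.IsNilpotent P := hP.isNilpotent
    have hlt := Group.normalizerCondition_of_isNilpotent (M.subgroupOf P)
      (lt_top_iff_ne_top.mpr fun h => hPM (subgroupOf_eq_top.mp h))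
    have hinf : (P ⊓ M).subgroupOf P = M.subgroupOf P := inf_subgroupOf_left M P
    rw [← hinf, ← subgroupOf_normalizer_eq inf_le_left, ← h, hinf] at hlt
    exact hlt.false

theorem exists_isTypeCFactor (hG : sigmaOne G < 3) (hn : ¬ Group.IsNilpotent G) :
    ∃ p : ℕ, p.Prime ∧ IsTypeCFactor p G := by
  obtain ⟨M, hM, hMn⟩ : ∃ M : Subgroup G, IsCoatom M ∧ ¬ M.Normal := by
    by_contra! h
    exact hn (((Group.isNilpotent_of_finite_tfae (G := G)).out 0 2).mpr h)
  have hself := hM.normalizer_eq_of_not_normal hMn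
  have hcyc := isCyclic_of_sigmaOne_lt_three hG hM hMn
  obtain ⟨p, hp, P, hP, hPM⟩ := exists_sylow_normal_not_le hG hself hM.1
  have := Fact.mk hp
  obtain ⟨K, hPK, hKM⟩ := exists_isComplement'_of_isCoatom P hM hPM
  have hK : K ≤ M := le_sup_left.trans_eq hKM
  have hMK : M ≤ centralizer (K : Set G) := fun m hm => mem_centralizer_iff.mpr fun k hk =>
    congrArg Subtype.val (IsCyclic.commGroup.mul_comm (⟨k, hK hk⟩ : M) ⟨m, hm⟩)
  -- By maximality of `M`, the only alternative is `K` central, which would make `G` nilpotent.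
  have hcent : centralizer (K : Set G) = M :=
    (hM.le_iff_eq fun h => hn (isNilpotent_of_isPGroup_of_isComplement' P.2 hPK
      (centralizer_eq_top_iff_subset.mp h))).mp hMK
  have hC : centralizerIn (P : Subgroup G) K = (P : Subgroup G) ⊓ M := by
    rw [centralizerIn, hcent]
  have hCn : ((P : Subgroup G) ⊓ M).Normal := normal_inf_of_isCoatom P.2 hM hPM
  refine ⟨p, hp, hn, P, K, hP, hPK, isCyclic_of_le hK, ?_, ?_, ?_⟩
  · rw [hC]
    exact le_inf (map_subtype_le _) (map_frattini_le_of_isCoatom hM hPM)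
  · rw [hC]
    exact isCyclic_of_le inf_le_right
  · rw [← hC] at hCn hKM
    rw [hKM]
    exact ⟨hCn, isCoatom_map_mk' hM (hC.trans_le inf_le_right)⟩

theorem sigmaOne_congr {G H : Type*} [Group G] [Group H] (e : G ≃* H) : sigmaOne G = sigmaOne H := by
  rw [sigmaOne, sigmaOne, Nat.card_congr e.toEquiv]
  congr 1
  refine finsum_eq_of_bijective e.mapSubgroup e.mapSubgroup.bijective fun L => ?_
  exact congrArg _ (Nat.card_congr (e.subgroupMap L).toEquiv)

end

theorem lemma2p1 (G : Type*) [Group G] [Finite G] (hG : sigmaOne G < 3) :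
    Group.IsNilpotent G ∨ IsTypeC G := by
  refine or_iff_not_imp_left.mpr fun hn => ?_
  have e : (⊤ : Subgroup G) ≃* G := topEquiv
  obtain ⟨p, hp, h⟩ := exists_isTypeCFactor (G := (⊤ : Subgroup G))
    (by rwa [sigmaOne_congr e])
    (fun _ => hn (Group.nilpotent_of_surjective e.toMonoidHom e.surjective))
  refine ⟨p, ⊤, ⊥, hp, isComplement'_top_bot, ?_, inferInstance, by simp, h⟩
  rintro x - y hy
  rw [mem_bot.mp hy, mul_one, one_mul]
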